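/- Let $H$ be a reproducing kernel Hilbert space of complex-valued functions on a set $X$: a complex Hilbert space of functions $X\to\mathbb{C}$ with kernel functions $k_x\in H$ such that $\langle f,k_x\rangle=f(x)$ for all $f\in H$, $x\in X$; its kernel is $K(x,y)=k_y(x)$. Assume that $H$ has a complete Nevanlinna–Pick kernel, that is, $K$ has no zeros on $X\times X$ and the function $1-1/K$ is positive semidefinite on $X\times X$. A multiplier of $H$ is a function $m:X\to\mathbb{C}$ such that $f\mapsto mf$ is a bounded map of $H$ into itself. Let $J\subseteq H$ be a closed subspace that is multiplier invariant, i.e. $mj\in J$ for every multiplier $m$ of $H$ and every $j\in J$, and let $J^\perp$ be its orthogonal complement in $H$. With the inner product of $H$, the spaces $J$ and $J^\perp$ are again reproducing kernel Hilbert spaces on $X$. For a reproducing kernel Hilbert space $L$ on $X$ with kernel functions $\ell_x$, and points $x,y\in X$ with $\ell_x\ne0$ and $\ell_y\ne0$, set $$\delta_L(x,y)=\sqrt{1-\left|\left\langle \frac{\ell_x}{\|\ell_x\|},\frac{\ell_y}{\|\ell_y\|}\right\rangle\right|^2};$$ $\delta_L(x,y)$ is left undefined if $\ell_x=0$ or $\ell_y=0$.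 Then for all $x,y\in X$ $$\delta_J(x,y)\ \ge\ \delta_H(x,y)\ \ge\ \delta_{J^\perp}(x,y),$$ where each of the two inequalities is asserted for all $x,y$ for which both of its sides are defined. -/

import Mathlib

open scoped ComplexOrder

namespace RKHS

/-- A linear subspace of a reproducing kernel Hilbert space of complex functions on `X`, with the
inherited inner product and the same point evaluations. -/
noncomputable instance submodule {X H : Type*} [NormedAddCommGroup H] [InnerProductSpace ℂ H]
    [RKHS ℂ H X ℂ] (J : Submodule ℂ H) : RKHS ℂ J X ℂ where
  coeCLM := (coeCLM ℂ : H →L[ℂ] X → ℂ) ∘L J.subtypeL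
  coeCLM_injective :=
    (coeCLM_injective : Function.Injective (coeCLM ℂ : H → X → ℂ)).comp Subtype.val_injective

theorem submodule_coe {X H : Type*} [NormedAddCommGroup H] [InnerProductSpace ℂ H]
    [RKHS ℂ H X ℂ] (J : Submodule ℂ H) (f : J) (x : X) : f x = (f : H) x := rfl

instance completeSpace_closedSubmodule {H : Type*} [NormedAddCommGroup H] [InnerProductSpace ℂ H]
    [CompleteSpace H] (J : ClosedSubmodule ℂ H) : CompleteSpace J.toSubmodule :=
  J.isClosed.completeSpace_coe

section Kernel

variable {X : Type*} (H : Type*) [NormedAddCommGroup H] [InnerProductSpace ℂ H]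
  [CompleteSpace H] [RKHS ℂ H X ℂ]

/-- The reproducing kernel `k_x ∈ H` of the point `x`. -/
noncomputable def kerVec (x : X) : H := kerFun H x (1 : ℂ)

/-- The reproducing property `⟨f, k_x⟩ = f(x)`; Mathlib's inner product is conjugate-linear in its
first variable. -/
theorem inner_kerVec_left (x : X) (f : H) : inner ℂ (kerVec H x) f = f x := by
  simp [kerVec]

/-- The scalar kernel function `K(x, y) = k_y(x)`. -/
noncomputable def scalarKernel (x y : X) : ℂ := kerVec H y x

/-- The unit vector `k_x / ‖k_x‖` (for `k_x ≠ 0`). -/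
noncomputable def unitKerVec (x : X) : H := ((‖kerVec H x‖⁻¹ : ℝ) : ℂ) • kerVec H x

/-- `δ_H(x, y) = √(1 - |⟨k_x/‖k_x‖, k_y/‖k_y‖⟩|²)`. Only meaningful if `k_x ≠ 0` and `k_y ≠ 0`. -/
noncomputable def delta (x y : X) : ℝ :=
  Real.sqrt (1 - ‖inner ℂ (unitKerVec H x) (unitKerVec H y)‖ ^ 2)

/-- `H` has a complete Nevanlinna–Pick kernel: `K` has no zeros (so that `1/K` makes sense) and
`1 - 1/K` is positive semidefinite on `X × X`. -/
def HasCompleteNPKernel : Prop :=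
  (∀ x y : X, scalarKernel H x y ≠ 0) ∧
    (Matrix.of fun x y : X => 1 - 1 / scalarKernel H x y).PosSemidef

/-- The bounded operator `M : H → H` is pointwise multiplication by the function `m`. A function
`m : X → ℂ` is a multiplier of `H` if such an `M` exists; `M` is then uniquely determined. -/
def IsMultiplicationBy (M : H →L[ℂ] H) (m : X → ℂ) : Prop :=
  ∀ (f : H) (x : X), M f x = m x * f x

/-- `J` is multiplier invariant: `m j ∈ J` for every `j ∈ J` and every multiplier `m` of `H`. -/
def MultiplierInvariant (J : Submodule ℂ H) : Prop :=
  ∀ (m : X → ℂ) (M : H →L[ℂ] H), IsMultiplicationBy H M m → ∀ j ∈ J, M j ∈ J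

end Kernel

end RKHS

namespace RKHS

/-! ### Gram kernels and Schur products. -/

section FeatureMap

variable {X ι E H : Type*} [NormedAddCommGroup E] [InnerProductSpace ℂ E]
  [NormedAddCommGroup H] [InnerProductSpace ℂ H]

/-! Let `P` be the projection onto `J`. Then `J` has kernel `L(x, y) = ⟨P k_x, P k_y⟩` (in the order
of `inner`), and everything rests on `G = L / K` being positive semidefinite
(`posSemidef_inner_starProjection_div`). Write `1 - 1/K` as a Gram kernel of vectors `e x`. Its
coordinates in a Hilbert basis give diagonal operators `N i` on the `k_x`, jointly contractive
because `K (1 - 1/K) = K - 1 ≤ K`, whose adjoints are multiplications. Invariance of `J` gives `P N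
i P = P N i`, so the contraction bound compresses to `(1 - 1/K) L ≤ L`, that is `G ≥ 0`. The 2×2
minors of `G` give the inequality for `J`. The kernel of `Jᗮ` is `K (1 - G)` with `G(x, x) ≤ 1`, and
`1 - G` satisfies a reversed Cauchy–Schwarz inequality. -/

theorem inner_self_eq_ofReal (v : H) : inner ℂ v v = ((‖v‖ ^ 2 : ℝ) : ℂ) := by
  rw [inner_self_eq_norm_sq_to_K, Complex.ofReal_pow]
  rfl

theorem inner_linearCombination (u v : X → H) (c : X →₀ ℂ) :
    inner ℂ (Finsupp.linearCombination ℂ u c) (Finsupp.linearCombination ℂ v c) =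
      (c.sum fun x a => c.sum fun y b => star a * inner ℂ (u x) (v y) * b : ℂ) := by
  rw [Finsupp.linearCombination_apply, Finsupp.linearCombination_apply]
  simp only [Finsupp.sum, sum_inner, inner_smul_left]
  refine Finset.sum_congr rfl fun x _ => ?_
  simp only [inner_sum, inner_smul_right, Finset.mul_sum]
  refine Finset.sum_congr rfl fun y _ => ?_
  rw [Complex.star_def]
  ring

/-- Expanding a feature map `e` along a Hilbert basis splits the Schur product of the Gram
kernels of `e` and `v` into a sum of Gram kernels. -/
theorem hasSum_inner_linearCombination (b : HilbertBasis ι ℂ E) (e : X → E) (v : X → H)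
    (c : X →₀ ℂ) :
    HasSum (fun i => inner ℂ (Finsupp.linearCombination ℂ (fun x => inner ℂ (b i) (e x) • v x) c)
        (Finsupp.linearCombination ℂ (fun x => inner ℂ (b i) (e x) • v x) c))
      (c.sum fun x a => c.sum fun y d =>
        star a * (inner ℂ (e x) (e y) * inner ℂ (v x) (v y)) * d : ℂ) := by
  simp only [inner_linearCombination, Finsupp.sum]
  refine hasSum_sum fun x _ => hasSum_sum fun y _ => ?_
  have h := (((b.hasSum_inner_mul_inner (e x) (e y)).mul_right (inner ℂ (v x) (v y))).mul_left
    (star (c x))).mul_right (c y)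
  refine h.congr_fun fun i => ?_
  rw [inner_smul_left, inner_smul_right, inner_conj_symm]
  ring

theorem finsuppSum_sub (M N : X → X → ℂ) (c : X →₀ ℂ) :
    (c.sum fun x a => c.sum fun y d => star a * (M x y - N x y) * d) =
      (c.sum fun x a => c.sum fun y d => star a * M x y * d) -
        c.sum fun x a => c.sum fun y d => star a * N x y * d := by
  simp only [Finsupp.sum, mul_sub, sub_mul, Finset.sum_sub_distrib]

end FeatureMap

universe u in
/-- A positive semidefinite scalar kernel is a Gram kernel in some Hilbert space. -/
theorem exists_featureMap {X : Type u} (F : Matrix X X ℂ) (hF : F.PosSemidef) :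
    ∃ (E : Type u) (_ : NormedAddCommGroup E) (_ : InnerProductSpace ℂ E) (_ : CompleteSpace E)
      (e : X → E), ∀ x y, F x y = inner ℂ (e x) (e y) := by
  -- The scalar kernel is recast as an operator-valued one, so that `OfKernel` supplies the Hilbert
  -- space.
  let L : Matrix X X (ℂ →L[ℂ] ℂ) := .of fun x y => F x y • (1 : ℂ →L[ℂ] ℂ)
  have hL : L.PosSemidef := by
    have hiff := (posSemidef_tfae (K := L)).out 0 2
    refine hiff.mpr ⟨?_, fun c => ?_⟩
    · ext x y
      simp [L, Matrix.conjTranspose_apply, ← hF.1.apply x y]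
    · have h := (Complex.le_def.mp (hF.2 c)).1
      refine h.trans_eq ?_
      rw [RCLike.re_eq_complex_re]
      refine congrArg Complex.re (Finsupp.sum_congr fun x _ => Finsupp.sum_congr fun y _ => ?_)
      rw [← hF.1.apply x y]
      simp [L]
      ring
  have : Fact L.PosSemidef := ⟨hL⟩
  refine ⟨OfKernel L, inferInstance, inferInstance, inferInstance,
    fun x => kerFun (OfKernel L) x (1 : ℂ), fun x y => ?_⟩
  rw [kerFun_inner, kerFun_apply, OfKernel.kernel_ofKernel]
  simp [L]

/-! ### Multipliers and compressions to invariant subspaces. -/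

section Kernel

variable {X : Type*} {H : Type*} [NormedAddCommGroup H] [InnerProductSpace ℂ H]
  [CompleteSpace H] [RKHS ℂ H X ℂ]

theorem scalarKernel_eq_inner (x y : X) :
    scalarKernel H x y = inner ℂ (kerVec H x) (kerVec H y) :=
  (inner_kerVec_left H x (kerVec H y)).symm

/-- A vector orthogonal to every `k_x` vanishes at every point. -/
theorem denseRange_linearCombination_kerVec :
    DenseRange (Finsupp.linearCombination ℂ (kerVec H : X → H)) := by
  have h : Dense (LinearMap.range (Finsupp.linearCombination ℂ (kerVec H : X → H)) : Set H) := by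
    rw [Submodule.dense_iff_topologicalClosure_eq_top, Submodule.topologicalClosure_eq_top_iff,
      Submodule.eq_bot_iff]
    refine fun f hf => RKHS.ext fun x => ?_
    rw [← inner_kerVec_left, coe_zero, Pi.zero_apply]
    exact hf _ ⟨Finsupp.single x 1, by simp⟩
  exact h

/-- A diagonal map `k_x ↦ ψ x • k_x` bounded on finite combinations of kernel functions extends
to the adjoint of a multiplication operator. -/
theorem exists_adjoint_isMultiplicationBy (ψ : X → ℂ)
    (h : ∀ c, ‖Finsupp.linearCombination ℂ (fun x => ψ x • kerVec H x) c‖ ≤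
      ‖Finsupp.linearCombination ℂ (kerVec H : X → H) c‖) :
    ∃ N : H →L[ℂ] H, (∀ x, N (kerVec H x) = ψ x • kerVec H x) ∧
      IsMultiplicationBy H (ContinuousLinearMap.adjoint N) (star ψ) := by
  have key : ∀ x, (Finsupp.linearCombination ℂ (fun x => ψ x • kerVec H x)).extendOfNorm
      (Finsupp.linearCombination ℂ (kerVec H : X → H)) (kerVec H x) = ψ x • kerVec H x := by
    intro x
    have := LinearMap.extendOfNorm_eq denseRange_linearCombination_kerVec
      ⟨1, fun c => by simpa using h c⟩ (Finsupp.single x 1)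
    simpa using this
  refine ⟨_, key, fun f x => ?_⟩
  rw [← inner_kerVec_left, ContinuousLinearMap.adjoint_inner_right, key, inner_smul_left,
    inner_kerVec_left, Pi.star_apply, Complex.star_def]

/-- Since the adjoint preserves `U`, `N` maps the orthogonal complement of `U` into itself. -/
theorem starProjection_comp_of_adjoint_mapsTo (U : Submodule ℂ H) [U.HasOrthogonalProjection]
    (N : H →L[ℂ] H) (hN : ∀ j ∈ U, ContinuousLinearMap.adjoint N j ∈ U) (f : H) :
    U.starProjection (N (U.starProjection f)) = U.starProjection (N f) := by
  rw [← sub_eq_zero, ← map_sub, ← map_sub, Submodule.starProjection_apply_eq_zero_iff]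
  intro j hj
  rw [← ContinuousLinearMap.adjoint_inner_left, ← neg_sub, inner_neg_right, neg_eq_zero]
  exact Submodule.sub_starProjection_mem_orthogonal f _ (hN j hj)

theorem linearCombination_comp_clm {X H Y : Type*} [NormedAddCommGroup H] [InnerProductSpace ℂ H]
     [NormedAddCommGroup Y] [InnerProductSpace ℂ Y]
    (P : H →L[ℂ] Y) (v : X → H) (c : X →₀ ℂ) :
    Finsupp.linearCombination ℂ (fun x => P (v x)) c = P (Finsupp.linearCombination ℂ v c) := by
  simp [Finsupp.linearCombination_apply, Finsupp.sum, map_sum]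

/-- The McCullough–Trent theorem: for a multiplier invariant subspace of a space with a complete
Nevanlinna–Pick kernel, the quotient of the two kernels is positive semidefinite. -/
theorem posSemidef_inner_starProjection_div (hNP : HasCompleteNPKernel H) (U : Submodule ℂ H)
    [U.HasOrthogonalProjection] (hU : MultiplierInvariant H U) :
    (Matrix.of fun x y : X => inner ℂ (U.starProjection (kerVec H x))
      (U.starProjection (kerVec H y)) / inner ℂ (kerVec H x) (kerVec H y)).PosSemidef := by
  obtain ⟨hK, hF⟩ := hNP
  simp only [scalarKernel_eq_inner] at hK hF
  obtain ⟨E, _, _, _, e, he⟩ := exists_featureMap _ hF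
  obtain ⟨w, b, -⟩ := exists_hilbertBasis ℂ E
  set A := Finsupp.linearCombination ℂ (kerVec H : X → H) with hA
  have hrow : ∀ (s : Finset w) (c : X →₀ ℂ),
      ∑ i ∈ s, ‖Finsupp.linearCombination ℂ
        (fun x => inner ℂ (b i) (e x) • kerVec H x) c‖ ^ 2 ≤ ‖A c‖ ^ 2 := by
    intro s c
    have h := sum_le_hasSum s (fun i _ => by
      rw [inner_self_eq_ofReal]; positivity)
      (hasSum_inner_linearCombination b e (kerVec H) c)
    -- Only here does the form of `e` enter the bound: the subtracted constant kernel `1`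
    -- contributes `|∑ c x|² ≥ 0`, which is dropped at the end.
    have h1 : ∀ x y, inner ℂ (e x) (e y) * inner ℂ (kerVec H x) (kerVec H y) =
        inner ℂ (kerVec H x) (kerVec H y) - 1 := by
      intro x y
      rw [← he, Matrix.of_apply]
      field_simp [hK x y]
    simp only [h1] at h
    rw [finsuppSum_sub, ← inner_linearCombination] at h
    have h2 : (c.sum fun x a => c.sum fun y d => star a * 1 * d : ℂ) =
        ((‖c.sum fun _ a => a‖ ^ 2 : ℝ) : ℂ) := by
      rw [Complex.ofReal_pow, ← Complex.conj_mul']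
      simp [Finsupp.sum, Finset.sum_mul_sum]
    rw [h2] at h
    simp only [inner_self_eq_ofReal] at h
    rw [← hA] at h
    have h3 : ∑ i ∈ s, ‖Finsupp.linearCombination ℂ
        (fun x => inner ℂ (b i) (e x) • kerVec H x) c‖ ^ 2 ≤
        ‖A c‖ ^ 2 - ‖c.sum fun _ a => a‖ ^ 2 := by
      exact_mod_cast h
    linarith [sq_nonneg ‖c.sum fun _ a => a‖]
  have hex : ∀ i : w, ∃ N : H →L[ℂ] H, (∀ x, N (kerVec H x) = inner ℂ (b i) (e x) • kerVec H x) ∧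
      IsMultiplicationBy H (ContinuousLinearMap.adjoint N) (star fun x => inner ℂ (b i) (e x)) := by
    refine fun i => exists_adjoint_isMultiplicationBy _ fun c => ?_
    have := hrow {i} c
    rw [Finset.sum_singleton] at this
    exact le_of_sq_le_sq this (norm_nonneg _)
  choose N hN hNm using hex
  have hcontr : ∀ (s : Finset w) (f : H), ∑ i ∈ s, ‖N i f‖ ^ 2 ≤ ‖f‖ ^ 2 := by
    intro s f
    refine denseRange_linearCombination_kerVec.induction_on (p := fun f : H =>
      ∑ i ∈ s, ‖N i f‖ ^ 2 ≤ ‖f‖ ^ 2) f (isClosed_le (by fun_prop) (by fun_prop)) fun c => ?_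
    simpa only [← linearCombination_comp_clm, hN] using hrow s c
  refine ⟨?_, fun c => ?_⟩
  · ext x y
    simp [Matrix.conjTranspose_apply]
  have hQ : (c.sum fun x a => c.sum fun y d => star a * (inner ℂ (e x) (e y) *
      inner ℂ (U.starProjection (kerVec H x)) (U.starProjection (kerVec H y))) * d : ℂ) ≤
      inner ℂ (U.starProjection (A c)) (U.starProjection (A c)) := by
    refine hasSum_le_of_sum_le (hasSum_inner_linearCombination b e
      (fun x => U.starProjection (kerVec H x)) c) fun s => ?_
    -- The inner projection, inserted by invariance, lets `hcontr` be applied to `P (A c)` instead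
    -- of `A c`.
    have h1 : ∀ i, Finsupp.linearCombination ℂ
        (fun x => inner ℂ (b i) (e x) • U.starProjection (kerVec H x)) c =
        U.starProjection (N i (U.starProjection (A c))) := by
      intro i
      rw [starProjection_comp_of_adjoint_mapsTo U (N i) (fun j hj => hU _ _ (hNm i) j hj),
        hA, ← linearCombination_comp_clm, ← linearCombination_comp_clm]
      simp only [hN, map_smul]
    simp only [h1, inner_self_eq_ofReal]
    have h2 : ∑ i ∈ s, ‖U.starProjection (N i (U.starProjection (A c)))‖ ^ 2 ≤
        ‖U.starProjection (A c)‖ ^ 2 := by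
      refine (Finset.sum_le_sum fun i _ => ?_).trans (hcontr s _)
      gcongr
      exact U.norm_starProjection_apply_le _
    exact_mod_cast h2
  have h1 : ∀ x y, (Matrix.of fun x y : X => inner ℂ (U.starProjection (kerVec H x))
      (U.starProjection (kerVec H y)) / inner ℂ (kerVec H x) (kerVec H y)) x y =
      inner ℂ (U.starProjection (kerVec H x)) (U.starProjection (kerVec H y)) -
      inner ℂ (e x) (e y) *
        inner ℂ (U.starProjection (kerVec H x)) (U.starProjection (kerVec H y)) := by
    intro x y
    rw [← he, Matrix.of_apply, Matrix.of_apply]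
    ring
  simp only [h1]
  rw [finsuppSum_sub, ← inner_linearCombination, linearCombination_comp_clm, sub_nonneg]
  exact hQ

/-! ### Distances in terms of projected kernel vectors. -/

theorem kerVec_submodule (U : Submodule ℂ H) [CompleteSpace U] (x : X) :
    (kerVec U x : H) = U.starProjection (kerVec H x) := by
  refine (Submodule.eq_starProjection_of_mem_of_inner_eq_zero (kerVec U x).2 fun f hf => ?_).symm
  rw [inner_sub_left, inner_kerVec_left, sub_eq_zero]
  exact (inner_kerVec_left U x ⟨f, hf⟩).symm

theorem delta_eq (x y : X) : delta H x y =
    Real.sqrt (1 - ‖inner ℂ (kerVec H x) (kerVec H y)‖ ^ 2 /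
      (‖kerVec H x‖ ^ 2 * ‖kerVec H y‖ ^ 2)) := by
  simp only [delta, unitKerVec, inner_smul_left, inner_smul_right, norm_mul, Complex.conj_ofReal,
    Complex.norm_real, norm_inv, norm_norm]
  congr 2
  ring

theorem delta_submodule_eq (U : Submodule ℂ H) [CompleteSpace U] (x y : X) : delta U x y =
    Real.sqrt (1 - ‖inner ℂ (U.starProjection (kerVec H x)) (U.starProjection (kerVec H y))‖ ^ 2 /
      (‖U.starProjection (kerVec H x)‖ ^ 2 * ‖U.starProjection (kerVec H y)‖ ^ 2)) := by
  simp only [delta_eq, Submodule.coe_inner, ← Submodule.norm_coe, kerVec_submodule]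

theorem sq_norm_starProjection_pos (U : Submodule ℂ H) [CompleteSpace U] {x : X}
    (hx : kerVec U x ≠ 0) : 0 < ‖U.starProjection (kerVec H x)‖ ^ 2 := by
  rw [← kerVec_submodule, Submodule.norm_coe]
  positivity

/-- This is nonnegativity of the 2×2 determinant on the indices `x, y`, which may coincide. -/
theorem sq_norm_le_of_posSemidef {M : Matrix X X ℂ} (hM : M.PosSemidef) (x y : X) :
    ‖M x y‖ ^ 2 ≤ (M x x).re * (M y y).re := by
  have h := (hM.submatrix ![x, y]).det_nonneg
  rw [Matrix.det_fin_two] at h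
  simp only [Matrix.submatrix_apply, Matrix.cons_val_zero, Matrix.cons_val_one] at h
  rw [← hM.1.apply y x, Complex.star_def, Complex.mul_conj'] at h
  have hx := hM.1.apply x x
  have hy := hM.1.apply y y
  rw [Complex.star_def, Complex.conj_eq_iff_im] at hx hy
  have := (Complex.le_def.mp h).1
  rw [← Complex.ofReal_pow] at this
  simp [hx, hy, -Complex.ofReal_pow] at this
  exact this

end Kernel
end RKHS

/-- For `a, b ≤ 1` and `|g|² ≤ a b`, the function `1 - g` satisfies the reverse of the
Cauchy–Schwarz inequality. -/
theorem one_sub_mul_one_sub_le_sq_norm {a b : ℝ} {g : ℂ} (ha : 0 ≤ a) (hb : 0 ≤ b)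
    (ha1 : a ≤ 1) (hb1 : b ≤ 1) (hg : ‖g‖ ^ 2 ≤ a * b) :
    (1 - a) * (1 - b) ≤ ‖1 - g‖ ^ 2 := by
  have h1 : 1 - ‖g‖ ≤ ‖1 - g‖ := by simpa using norm_sub_norm_le 1 g
  have hr := Real.sq_sqrt (mul_nonneg ha hb)
  have hr0 := Real.sqrt_nonneg (a * b)
  have hr1 : Real.sqrt (a * b) ≤ 1 := Real.sqrt_le_one.mpr (mul_le_one₀ ha1 hb hb1)
  have hgr : ‖g‖ ≤ Real.sqrt (a * b) := Real.le_sqrt_of_sq_le hg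
  -- AM–GM yields `(1 - a)(1 - b) ≤ (1 - √(ab))²`.
  have hab : 2 * Real.sqrt (a * b) ≤ a + b :=
    le_of_sq_le_sq (by nlinarith [sq_nonneg (a - b)]) (by positivity)
  calc (1 - a) * (1 - b) ≤ (1 - Real.sqrt (a * b)) ^ 2 := by linarith
    _ ≤ ‖1 - g‖ ^ 2 := pow_le_pow_left₀ (by linarith) (by linarith) 2

theorem mainTheorem1 {X : Type*} {H : Type*} [NormedAddCommGroup H] [InnerProductSpace ℂ H]
    [CompleteSpace H] [RKHS ℂ H X ℂ] (hNP : RKHS.HasCompleteNPKernel H)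
    (J : ClosedSubmodule ℂ H) (hJ : RKHS.MultiplierInvariant H J.toSubmodule) (x y : X) :
    (RKHS.kerVec J.toSubmodule x ≠ 0 → RKHS.kerVec J.toSubmodule y ≠ 0 →
      RKHS.delta H x y ≤ RKHS.delta J.toSubmodule x y) ∧
    (RKHS.kerVec Jᗮ.toSubmodule x ≠ 0 → RKHS.kerVec Jᗮ.toSubmodule y ≠ 0 →
      RKHS.delta Jᗮ.toSubmodule x y ≤ RKHS.delta H x y) := by
  have hP := RKHS.posSemidef_inner_starProjection_div hNP J.toSubmodule hJ
  have hPxy := RKHS.sq_norm_le_of_posSemidef hP x y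
  have hK : ∀ z w : X, inner ℂ (RKHS.kerVec H z) (RKHS.kerVec H w) ≠ 0 := fun z w => by
    rw [← RKHS.scalarKernel_eq_inner]
    exact hNP.1 z w
  have hk : ∀ z : X, 0 < ‖RKHS.kerVec H z‖ ^ 2 := fun z => by
    have : RKHS.kerVec H z ≠ 0 := fun h => hK z z (by rw [h, inner_zero_left])
    positivity
  simp only [Matrix.of_apply, RKHS.inner_self_eq_ofReal, ← Complex.ofReal_div,
    Complex.ofReal_re] at hPxy
  rw [RKHS.delta_submodule_eq, RKHS.delta_submodule_eq, RKHS.delta_eq]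
  constructor
  · intro hx hy
    have hx' := RKHS.sq_norm_starProjection_pos _ hx
    have hy' := RKHS.sq_norm_starProjection_pos _ hy
    refine Real.sqrt_le_sqrt (sub_le_sub_left ?_ _)
    rw [norm_div, div_pow, div_mul_div_comm] at hPxy
    have hKp : 0 < ‖inner ℂ (RKHS.kerVec H x) (RKHS.kerVec H y)‖ ^ 2 := by
      have := norm_pos_iff.mpr (hK x y)
      positivity
    have hkk := mul_pos (hk x) (hk y)
    rw [div_le_div_iff₀ hKp hkk] at hPxy
    rw [div_le_div_iff₀ (mul_pos hx' hy') hkk]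
    linarith
  · intro hx hy
    refine Real.sqrt_le_sqrt (sub_le_sub_left ?_ _)
    have hcompl : ∀ z : X, Jᗮ.toSubmodule.starProjection (RKHS.kerVec H z) =
        RKHS.kerVec H z - J.toSubmodule.starProjection (RKHS.kerVec H z) :=
      fun z => Submodule.starProjection_orthogonal_val _
    have hsplit : ∀ z : X, ‖Jᗮ.toSubmodule.starProjection (RKHS.kerVec H z)‖ ^ 2 =
        ‖RKHS.kerVec H z‖ ^ 2 * (1 - ‖J.toSubmodule.starProjection (RKHS.kerVec H z)‖ ^ 2 /
          ‖RKHS.kerVec H z‖ ^ 2) := fun z => by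
      have := Submodule.norm_sq_eq_add_norm_sq_starProjection (RKHS.kerVec H z) J.toSubmodule
      rw [Submodule.starProjection_orthogonal_val, ← hcompl] at this
      rw [mul_sub, mul_one, mul_div_cancel₀ _ (hk z).ne']
      linarith
    have hle : ∀ z : X, ‖J.toSubmodule.starProjection (RKHS.kerVec H z)‖ ^ 2 /
        ‖RKHS.kerVec H z‖ ^ 2 ≤ 1 := fun z => by
      rw [div_le_one (hk z)]
      gcongr
      exact Submodule.norm_starProjection_apply_le _ _
    have key := one_sub_mul_one_sub_le_sq_norm (by positivity) (by positivity) (hle x) (hle y) hPxy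
    have hinner : inner ℂ (Jᗮ.toSubmodule.starProjection (RKHS.kerVec H x))
        (Jᗮ.toSubmodule.starProjection (RKHS.kerVec H y)) =
        inner ℂ (RKHS.kerVec H x) (RKHS.kerVec H y) *
        (1 - inner ℂ (J.toSubmodule.starProjection (RKHS.kerVec H x))
          (J.toSubmodule.starProjection (RKHS.kerVec H y)) /
          inner ℂ (RKHS.kerVec H x) (RKHS.kerVec H y)) := by
      have h0 := Submodule.starProjection_inner_eq_zero (K := J.toSubmodule) (RKHS.kerVec H x) _
        (J.toSubmodule.starProjection_apply_mem (RKHS.kerVec H y))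
      have h1 := J.toSubmodule.inner_starProjection_left_eq_right (RKHS.kerVec H x)
        (RKHS.kerVec H y)
      rw [inner_sub_left] at h0
      rw [mul_sub, mul_one, mul_div_cancel₀ _ (hK x y), hcompl, hcompl, inner_sub_left,
        inner_sub_right, inner_sub_right, h1]
      -- Both cross terms equal `⟨P k_x, P k_y⟩`, hence the factor 2.
      linear_combination (-2 : ℂ) * h0
    have hx' := RKHS.sq_norm_starProjection_pos _ hx
    have hy' := RKHS.sq_norm_starProjection_pos _ hy
    rw [div_le_div_iff₀ (mul_pos (hk x) (hk y)) (mul_pos hx' hy'), hinner, hsplit, hsplit, norm_mul,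
      mul_pow]
    calc _ = ‖inner ℂ (RKHS.kerVec H x) (RKHS.kerVec H y)‖ ^ 2 *
          (‖RKHS.kerVec H x‖ ^ 2 * ‖RKHS.kerVec H y‖ ^ 2) *
          ((1 - ‖J.toSubmodule.starProjection (RKHS.kerVec H x)‖ ^ 2 / ‖RKHS.kerVec H x‖ ^ 2) *
          (1 - ‖J.toSubmodule.starProjection (RKHS.kerVec H y)‖ ^ 2 / ‖RKHS.kerVec H y‖ ^ 2)) := by
          ring
      _ ≤ _ := by
          refine (mul_le_mul_of_nonneg_left key (by positivity)).trans_eq ?_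
          ring
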